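/- Let $F$ be the space of all finite non-empty subsets of $\mathbb{C}$, topologized by the basic open sets $U_{\{O_i\}_{i\in I},N}=\{A\in F : A\cap O_i\neq\emptyset \text{ for all } i\in I,\ A\subseteq N\}$ with $I$ finite and $O_i,N\subseteq\mathbb{C}$ open; such a set is in normal form if $N=\bigcup_{i\in I} O_i$. Work in the topological (sheaf) model over $F$, whose truth values are the open subsets of $F$ and whose real and complex numbers are those given by Dedekind cuts; every ground-model number is identified with its canonical copy in the model. Let $H$ be the largest set of complex numbers of the model such that every basic open set $U_{\{O_i\},\bigcup_i O_i}$ in normal form forces $H\subseteq\bigcup_i O_i$ (with $\bigcup_i O_i$ reinterpreted in the model). Let $R$ be the Riesz space of functions $\mathbb{C}\to\mathbb{R}$ generated by the constant $1$ and the coordinate projections $x,y$, and let $R'$ be the space obtained from the same generators by closing under the Riesz space operations and squaring. They are regarded as Riesz spaces of the model by letting $U_{\{O_i\},N}$ force $r=s$ if $r$ and $s$ agree on $N$, with $r\le s$ meaning $r\wedge s=r$. For such an $r$, and for rational $q$, let $q<r$ mean that $p\cdot 1\le r$ for some rational $p>q$; $\inf(r)$ denotes the real number of the model (if it is one) with lower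 cut $\{q\in\mathbb{Q} : q<r\}$ and upper cut $\{q\in\mathbb{Q} : \neg(p<r)\text{ for some rational } p<q\}$. Then $H$ has no points: no non-empty open subset of $F$ forces any $z$ to be in $H$. Nevertheless there is in the model a non-trivial distance function to $H$, both for the taxicab metric and for the Euclidean metric $m$ on $\mathbb{C}$. That is, for each of the two metrics there is a function $d(\cdot,H):\mathbb{C}\to\mathbb{R}$ of the model such that: 1. for every ground-model $z=(x_z,y_z)\in\mathbb{C}$: in the taxicab case $|x-x_z|+|y-y_z|\in R$ and $$d(z,H)=\inf\bigl(|x-x_z|+|y-y_z|\bigr),$$ computed in $R$; in the Euclidean case $|x-x_z|^2+|y-y_z|^2\in R'$ and $$d(z,H)=\sqrt{\inf\bigl(|x-x_z|^2+|y-y_z|^2\bigr)},$$ the infimum being computed in $R'$; in particular these infima exist as real numbers of the model; 2. the model satisfies, for all of its complex numbers $z,w$: $d(z,H)\ge 0$; $d(z,H)-d(w,H)\le m(z,w)$; and $d(z,H)=0$ if and only if $z\in H$; 3. if $U$ is a basic open set in normal form, with positive information $\{O_i\}$, and $z\in\mathbb{C}$, then $U$ forces $\rho\le d(z,H)$ for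 every rational $\rho$ that is at most $m(z,w)$ for all $w\in\bigcup_i O_i$; and if moreover each two points of a single $O_i$ are at $m$-distance less than $\varepsilon$, then $U$ forces $d(z,H)<q$ for every rational $q$ with $q\ge m(z,w)+\varepsilon$ for some $w\in\bigcup_i O_i$ (so $d(z,H)$ lies between the distance from $z$ to $\bigcup_i O_i$ and that distance plus $\varepsilon$); 4. the model satisfies that $d(\cdot,H)$ takes values below every rational $\varepsilon>0$ and values above every rational $K$, already at ground-model points $z$. -/

import Mathlib

open TopologicalSpace

namespace PointlessModel

/-! ### The space of finite non-empty sets of complex numbers -/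

/-- The finite non-empty subsets of `ℂ`. -/
def F : Type := {A : Set ℂ // A.Finite ∧ A.Nonempty}

/-- The set of all `A` in `F` that meet every member of `P` (the positive information) and are
contained in `N` (the negative information). -/
def basicSet (P : Set (Opens ℂ)) (N : Opens ℂ) : Set F :=
  {A | (∀ O ∈ P, (A.1 ∩ (O : Set ℂ)).Nonempty) ∧ A.1 ⊆ (N : Set ℂ)}

/-- The topology on `F` generated by the basic sets with finitely many pieces of positive
information. -/
instance instTopologicalSpaceF : TopologicalSpace F :=
  TopologicalSpace.generateFrom {s | ∃ P : Set (Opens ℂ), P.Finite ∧ ∃ N, s = basicSet P N}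

/-- The basic open sets, as elements of the Heyting algebra of truth values. -/
noncomputable def basicOpen (P : Set (Opens ℂ)) (hP : P.Finite) (N : Opens ℂ) : Opens F :=
  ⟨basicSet P N, TopologicalSpace.isOpen_generateFrom_of_mem ⟨P, hP, N, rfl⟩⟩

/-- The basic open set in normal form with positive information `P`: the negative information
is the union of `P`. -/
noncomputable def normalOpen (P : Set (Opens ℂ)) (hP : P.Finite) : Opens F :=
  basicOpen P hP (sSup P)

/-! ### The Dedekind real and complex numbers of the sheaf model over `F`

Truth values are the open sets of `F`.  A subset of the rationals of the model, at the stage `V`,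
is a family of opens `q ↦ ⟦q ∈ S⟧ ≤ V` indexed by the (external) rationals. -/

/-- The real numbers of the model at the stage `V`: pairs of families of truth values that are
forced by `V` to be a Dedekind cut.  Here `lower q` is the truth value of `q < x` and `upper q`
that of `x < q`. -/
@[ext]
structure DReal (V : Opens F) where
  lower : ℚ → Opens F
  upper : ℚ → Opens F
  lower_le : ∀ q, lower q ≤ V
  upper_le : ∀ q, upper q ≤ V
  lower_inhabited : V ≤ ⨆ q, lower q
  upper_inhabited : V ≤ ⨆ q, upper q
  lower_rounded : ∀ q, lower q = ⨆ (p : ℚ) (_ : q < p), lower p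
  upper_rounded : ∀ q, upper q = ⨆ (p : ℚ) (_ : p < q), upper p
  disjoint : ∀ q, lower q ⊓ upper q = ⊥
  located : ∀ p q, p < q → V ≤ lower p ⊔ upper q

/-- Restriction of a real number of the model to a smaller stage. -/
def DReal.restrict {V W : Opens F} (h : W ≤ V) (x : DReal V) : DReal W where
  lower q := x.lower q ⊓ W
  upper q := x.upper q ⊓ W
  lower_le _ := inf_le_right
  upper_le _ := inf_le_right
  lower_inhabited := by
    rw [← iSup_inf_eq]; exact le_inf (h.trans x.lower_inhabited) le_rfl
  upper_inhabited := by
    rw [← iSup_inf_eq]; exact le_inf (h.trans x.upper_inhabited) le_rfl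
  lower_rounded q := by
    conv_lhs => rw [x.lower_rounded q]
    simp only [iSup_inf_eq]
  upper_rounded q := by
    conv_lhs => rw [x.upper_rounded q]
    simp only [iSup_inf_eq]
  disjoint q := by
    rw [← inf_inf_distrib_right, x.disjoint q, bot_inf_eq]
  located p q hpq := by
    rw [← inf_sup_right]; exact le_inf (h.trans (x.located p q hpq)) le_rfl

/-- The complex numbers of the model at the stage `V`. -/
@[ext]
structure DComplex (V : Opens F) where
  re : DReal V
  im : DReal V

/-- Restriction of a complex number of the model to a smaller stage. -/
def DComplex.restrict {V W : Opens F} (h : W ≤ V) (z : DComplex V) : DComplex W :=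
  ⟨z.re.restrict h, z.im.restrict h⟩

/-- The ground-model real number `r`, as a real number of the model. -/
noncomputable def DReal.const (r : ℝ) : DReal ⊤ where
  lower q := ⨆ _ : (q : ℝ) < r, ⊤
  upper q := ⨆ _ : r < (q : ℝ), ⊤
  lower_le _ := le_top
  upper_le _ := le_top
  lower_inhabited := by
    obtain ⟨q, hq⟩ := exists_rat_lt r
    exact le_iSup_of_le q (le_iSup_of_le hq le_rfl)
  upper_inhabited := by
    obtain ⟨q, hq⟩ := exists_rat_gt r
    exact le_iSup_of_le q (le_iSup_of_le hq le_rfl)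
  lower_rounded q := by
    apply le_antisymm
    · refine iSup_le fun h => ?_
      obtain ⟨p, hp, hp'⟩ := exists_rat_btwn h
      exact le_iSup_of_le p (le_iSup_of_le (by exact_mod_cast hp) (le_iSup_of_le hp' le_rfl))
    · refine iSup_le fun p => iSup_le fun hp => iSup_le fun h => ?_
      exact le_iSup_of_le (lt_trans (by exact_mod_cast hp) h) le_rfl
  upper_rounded q := by
    apply le_antisymm
    · refine iSup_le fun h => ?_
      obtain ⟨p, hp, hp'⟩ := exists_rat_btwn h
      exact le_iSup_of_le p (le_iSup_of_le (by exact_mod_cast hp') (le_iSup_of_le hp le_rfl))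
    · refine iSup_le fun p => iSup_le fun hp => iSup_le fun h => ?_
      exact le_iSup_of_le (lt_trans h (by exact_mod_cast hp)) le_rfl
  disjoint q := by
    rcases lt_or_ge (q : ℝ) r with h | h
    · simp [not_lt.2 h.le]
    · simp [not_lt.2 h]
  located p q hpq := by
    rcases lt_or_ge (p : ℝ) r with h | h
    · exact le_sup_of_le_left (le_iSup_of_le h le_rfl)
    · have h' : r < (q : ℝ) := lt_of_le_of_lt h (by exact_mod_cast hpq)
      exact le_sup_of_le_right (le_iSup_of_le h' le_rfl)

/-- The ground-model complex number `z`, as a complex number of the model. -/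
noncomputable def DComplex.const (z : ℂ) : DComplex ⊤ := ⟨DReal.const z.re, DReal.const z.im⟩

/-- A function of the model from its complex numbers to its real numbers: a morphism of
sheaves. -/
structure DFun where
  app : ∀ V : Opens F, DComplex V → DReal V
  app_restrict : ∀ (V W : Opens F) (h : W ≤ V) (z : DComplex V),
    app W (z.restrict h) = (app V z).restrict h

/-! ### Truth values of some statements about numbers of the model -/

/-- The truth value of `x - y < q`: some rational `s` has `x < s + q` and `s < y`. -/
def subLt {V : Opens F} (x y : DReal V) (q : ℚ) : Opens F :=
  ⨆ s : ℚ, x.upper (s + q) ⊓ y.lower s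

/-- The truth value of `|x - y| < q`. -/
def absSubLt {V : Opens F} (x y : DReal V) (q : ℚ) : Opens F :=
  subLt x y q ⊓ subLt y x q

/-- The truth value of `|re z - re w| + |im z - im w| < q`. -/
def taxiLt (V : Opens F) (z w : DComplex V) (q : ℚ) : Opens F :=
  ⨆ (a : ℚ) (b : ℚ) (_ : a + b ≤ q), absSubLt z.re w.re a ⊓ absSubLt z.im w.im b

/-- The truth value of `√(|re z - re w|² + |im z - im w|²) < q`. -/
def euclidLt (V : Opens F) (z w : DComplex V) (q : ℚ) : Opens F :=
  ⨆ (a : ℚ) (b : ℚ) (_ : 0 < q ∧ a ^ 2 + b ^ 2 ≤ q ^ 2),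
    absSubLt z.re w.re a ⊓ absSubLt z.im w.im b

/-- The truth value of `z ∈ N`, where `N` is reinterpreted in the model as the union of
the open rectangles with rational corners that it contains. -/
noncomputable def memOpen {V : Opens F} (z : DComplex V) (N : Opens ℂ) : Opens F :=
  ⨆ (a : ℚ) (b : ℚ) (c : ℚ) (e : ℚ)
    (_ : ∀ w : ℂ, (a : ℝ) < w.re → w.re < b → (c : ℝ) < w.im → w.im < e → w ∈ N),
    (z.re.lower a ⊓ z.re.upper b) ⊓ (z.im.lower c ⊓ z.im.upper e)

/-- `e` is the non-negative square root of `y`, at the stage `V`: `q < e` iff `q < 0` or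
`q² < y`, and `e < q` iff `0 < q` and `y < q²`. -/
def IsSqrt {V : Opens F} (e y : DReal V) : Prop :=
  (∀ q < 0, e.lower q = V) ∧ (∀ q, 0 ≤ q → e.lower q = y.lower (q ^ 2)) ∧
    (∀ q ≤ 0, e.upper q = ⊥) ∧ (∀ q, 0 < q → e.upper q = y.upper (q ^ 2))

/-! ### The pointless set -/

/-- The truth value of `z ∈ H`.  The set `H` is the largest set of complex numbers of the model
such that every basic open set in normal form forces `H` to be contained in the union of its
positive information. -/
noncomputable def memH {V : Opens F} (z : DComplex V) : Opens F :=
  V ⊓ ⨅ (P : Set (Opens ℂ)) (hP : P.Finite), (normalOpen P hP ⇨ memOpen z (sSup P))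

/-! ### The Riesz space of the model -/

/-- A set of functions closed under the Riesz space operations. -/
structure IsRieszSubspace (S : Set (ℂ → ℝ)) : Prop where
  zero_mem : 0 ∈ S
  add_mem : ∀ f ∈ S, ∀ g ∈ S, f + g ∈ S
  smul_mem : ∀ (c : ℝ), ∀ f ∈ S, c • f ∈ S
  sup_mem : ∀ f ∈ S, ∀ g ∈ S, f ⊔ g ∈ S
  inf_mem : ∀ f ∈ S, ∀ g ∈ S, f ⊓ g ∈ S

/-- The generators: the constant `1` and the two coordinate projections. -/
def generators : Set (ℂ → ℝ) := {1, Complex.re, Complex.im}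

/-- The Riesz space `R` generated by the generators. -/
def rieszR : Set (ℂ → ℝ) :=
  ⋂₀ {S | IsRieszSubspace S ∧ generators ⊆ S}

/-- The enlarged Riesz space, generated under the Riesz space operations and squaring. -/
def rieszRSq : Set (ℂ → ℝ) :=
  ⋂₀ {S | IsRieszSubspace S ∧ (∀ f ∈ S, f ^ 2 ∈ S) ∧ generators ⊆ S}

/-- The truth value of `r = s` in the Riesz space of the model: a basic open set with negative
information `N` forces it if `r` and `s` agree on `N`. -/
noncomputable def rieszEq (r s : ℂ → ℝ) : Opens F :=
  ⨆ (P : Set (Opens ℂ)) (hP : P.Finite) (N : Opens ℂ) (_ : ∀ w ∈ N, r w = s w), basicOpen P hP N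

/-- The truth value of `r ≤ s` in the Riesz space of the model. -/
noncomputable def rieszLe (r s : ℂ → ℝ) : Opens F := rieszEq (r ⊓ s) r

/-- The truth value of `q < r` in the Riesz space of the model: `p • 1 ≤ r` for some rational
`p > q`. -/
noncomputable def rieszRatLt (q : ℚ) (r : ℂ → ℝ) : Opens F :=
  ⨆ (p : ℚ) (_ : q < p), rieszLe ((p : ℝ) • (1 : ℂ → ℝ)) r

/-- The real number `x` of the model is the infimum of the element `r` of the Riesz space of the
model: its lower cut is `{q | q < r}`, and `x < q` means that `¬ (p < r)` for some `p < q`. -/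
def IsRieszInf (r : ℂ → ℝ) (x : DReal ⊤) : Prop :=
  (∀ q, x.lower q = rieszRatLt q r) ∧
    (∀ q, x.upper q = ⨆ (p : ℚ) (_ : p < q), (rieszRatLt p r)ᶜ)

/-! ### Non-trivial distance functions to the pointless set -/

/-- The taxicab metric on `ℂ`. -/
noncomputable def taxi (z w : ℂ) : ℝ := |z.re - w.re| + |z.im - w.im|

/-- The element `|x - x_z| + |y - y_z|` of `R`. -/
noncomputable def taxiElt (z : ℂ) : ℂ → ℝ := fun w => |w.re - z.re| + |w.im - z.im|

/-- The element `|x - x_z|² + |y - y_z|²` of the enlarged Riesz space. -/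
noncomputable def euclidElt (z : ℂ) : ℂ → ℝ := fun w => |w.re - z.re| ^ 2 + |w.im - z.im| ^ 2

/-- `d` is, in the model, a non-trivial distance function to `H`, with respect to the
metric `m` on `ℂ` that is given inside the model by the truth values `mLt V z w q` of
`m(z, w) < q`. -/
structure IsNontrivialDistanceToH (m : ℂ → ℂ → ℝ)
    (mLt : ∀ V : Opens F, DComplex V → DComplex V → ℚ → Opens F) (d : DFun) : Prop where
  /-- `d ≥ 0`. -/
  nonneg : ∀ (V : Opens F) (z : DComplex V), ∀ q < 0, (d.app V z).lower q = V
  /-- `d(z) - d(w) ≤ m(z, w)`. -/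
  lipschitz : ∀ (V : Opens F) (z w : DComplex V) (q : ℚ),
    mLt V z w q ≤ subLt (d.app V z) (d.app V w) q
  /-- `d(z) = 0`, which means `¬ (0 < d(z))`, exactly if `z ∈ H`. -/
  zero_iff : ∀ (V : Opens F) (z : DComplex V), V ⊓ ((d.app V z).lower 0)ᶜ = memH z
  /-- A basic open set in normal form forces `d(z)` to be at least the distance from `z` to the
  union `N` of its positive information. -/
  lower_bound : ∀ (P : Set (Opens ℂ)) (hP : P.Finite) (z : ℂ) (q : ℚ),
    (∀ w ∈ sSup P, (q : ℝ) ≤ m z w) →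
      normalOpen P hP ⊓ (d.app ⊤ (DComplex.const z)).upper q = ⊥
  /-- If moreover its positive pieces have `m`-diameter less than `ε`, then it forces `d(z)` to be
  at most that distance plus `ε`. -/
  upper_bound : ∀ (P : Set (Opens ℂ)) (hP : P.Finite) (ε : ℝ) (z : ℂ) (q : ℚ),
    (∀ O ∈ P, ∀ a ∈ O, ∀ b ∈ O, m a b < ε) →
      (∃ w ∈ sSup P, m z w + ε ≤ q) →
        normalOpen P hP ≤ (d.app ⊤ (DComplex.const z)).upper q
  /-- `d` takes arbitrarily small values. -/
  exists_small : ∀ ε : ℚ, 0 < ε → (⨆ z : ℂ, (d.app ⊤ (DComplex.const z)).upper ε) = ⊤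
  /-- `d` takes arbitrarily large values. -/
  exists_large : ∀ K : ℚ, (⨆ z : ℂ, (d.app ⊤ (DComplex.const z)).lower K) = ⊤

end PointlessModel

open PointlessModel

namespace PointlessModel

/-! ### The topology of `F` -/

/-! A Dedekind real of the model at stage `V` is a continuous function `V → ℝ`, so a complex number
of the model is a continuous map from `V` to `ℂ`, and every truth value can be computed pointwise at
the finite sets `A`.

If `A` lies in the truth value of `z ∈ H`, then `z(A) ∈ A`, because otherwise the complement of the
point `z(A)` would be a normal-form constraint violated by `z`. A point of `H` would therefore be a
continuous choice of a member of `A` on an open set. None exists on a non-empty one: replace the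
chosen point `a` by the pair `a + u`, `a - u` and let `u` run along a half circle around `0`. The
chosen sign is continuous, hence constant, yet the pair is the same at both ends while `u` has
changed sign (`eq_empty_of_continuousOn_selection`).

The distance to `H` is the function `A ↦ min {m(z(A), a) : a ∈ A}`. Minima over `A` are continuous
in `A` (`continuous_minOn`), and `q < r` holds at `A` in the Riesz space exactly when `q` is below
the minimum of `r` on `A` (`mem_rieszRatLt_iff`), so this function is the required infimum. Where it
vanishes, `z(A) ∈ A`; so `d(z) = 0` and `z ∈ H` both have truth value `⊥`. The other properties are
pointwise facts about finite sets. -/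

theorem isOpen_meets {O : Set ℂ} (hO : IsOpen O) : IsOpen {A : F | (A.1 ∩ O).Nonempty} := by
  apply TopologicalSpace.isOpen_generateFrom_of_mem
  refine ⟨{⟨O, hO⟩}, Set.finite_singleton _, ⊤, ?_⟩
  ext A
  simp [basicSet]

theorem isOpen_subset {N : Set ℂ} (hN : IsOpen N) : IsOpen {A : F | A.1 ⊆ N} := by
  apply TopologicalSpace.isOpen_generateFrom_of_mem
  refine ⟨∅, Set.finite_empty, ⟨N, hN⟩, ?_⟩
  ext A
  simp [basicSet]

theorem continuous_of_isOpen_meets_of_isOpen_subset {X : Type*} [TopologicalSpace X] {f : X → F}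
    (hmeets : ∀ O : Opens ℂ, IsOpen {x | ((f x).1 ∩ (O : Set ℂ)).Nonempty})
    (hsubset : ∀ N : Opens ℂ, IsOpen {x | (f x).1 ⊆ (N : Set ℂ)}) : Continuous f := by
  refine continuous_generateFrom_iff.2 ?_
  rintro _ ⟨P, hP, N, rfl⟩
  have h : f ⁻¹' basicSet P N =
      (⋂ O ∈ P, {x | ((f x).1 ∩ (O : Set ℂ)).Nonempty}) ∩ {x | (f x).1 ⊆ (N : Set ℂ)} := by
    ext x
    simp [basicSet]
  rw [h]
  exact (hP.isOpen_biInter fun O _ => hmeets O).inter (hsubset N)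

theorem mem_normalOpen {P : Set (Opens ℂ)} {hP : P.Finite} {A : F} :
    A ∈ normalOpen P hP ↔
      (∀ O ∈ P, (A.1 ∩ (O : Set ℂ)).Nonempty) ∧ A.1 ⊆ ((sSup P : Opens ℂ) : Set ℂ) :=
  Iff.rfl

/-- The set `A` with its point `a` replaced by the two points `a + u` and `a - u`. -/
noncomputable def splitPoint (A : F) (a u : ℂ) : F :=
  ⟨(A.1 \ {a}) ∪ {a + u, a - u}, (A.2.1.sdiff).union (Set.toFinite _),
    ⟨a + u, Or.inr (Or.inl rfl)⟩⟩

theorem continuous_splitPoint (A : F) (a : ℂ) : Continuous (splitPoint A a) := by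
  have hadd : Continuous fun u : ℂ => a + u := by fun_prop
  have hsub : Continuous fun u : ℂ => a - u := by fun_prop
  refine continuous_of_isOpen_meets_of_isOpen_subset (fun O => ?_) (fun N => ?_)
  · have h : {u | ((splitPoint A a u).1 ∩ (O : Set ℂ)).Nonempty} =
        {_u | ((A.1 \ {a}) ∩ (O : Set ℂ)).Nonempty} ∪
          ((fun u => a + u) ⁻¹' O ∪ (fun u => a - u) ⁻¹' O) := by
      ext u
      simp only [splitPoint, Set.union_inter_distrib_right, Set.union_nonempty, Set.mem_ofPred_eq,
        Set.mem_union, Set.mem_preimage]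
      refine or_congr_right ⟨?_, ?_⟩
      · rintro ⟨w, rfl | rfl, hw⟩
        exacts [Or.inl hw, Or.inr hw]
      · rintro (hw | hw)
        exacts [⟨_, Or.inl rfl, hw⟩, ⟨_, Or.inr rfl, hw⟩]
    rw [h]
    exact isOpen_const.union ((O.2.preimage hadd).union (O.2.preimage hsub))
  · have h : {u | (splitPoint A a u).1 ⊆ (N : Set ℂ)} =
        {_u | A.1 \ {a} ⊆ (N : Set ℂ)} ∩ ((fun u => a + u) ⁻¹' N ∩ (fun u => a - u) ⁻¹' N) := by
      ext u
      simp only [splitPoint, Set.union_subset_iff, Set.insert_subset_iff,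
        Set.singleton_subset_iff, Set.mem_ofPred_eq, Set.mem_inter_iff, Set.mem_preimage]
    rw [h]
    exact isOpen_const.inter ((N.2.preimage hadd).inter (N.2.preimage hsub))

theorem splitPoint_zero {A : F} {a : ℂ} (ha : a ∈ A.1) : splitPoint A a 0 = A := by
  apply Subtype.ext
  simp [splitPoint, Set.insert_eq_of_mem ha]

theorem splitPoint_neg (A : F) (a u : ℂ) : splitPoint A a (-u) = splitPoint A a u := by
  apply Subtype.ext
  simp only [splitPoint, sub_neg_eq_add, ← sub_eq_add_neg]
  rw [Set.pair_comm]

/-- There is no continuous choice of a member of `A`, for `A` in a non-empty open set of `F`. -/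
theorem eq_empty_of_continuousOn_selection {W : Set F} (hW : IsOpen W) {ζ : F → ℂ}
    (hζ : ContinuousOn ζ W) (hmem : ∀ A ∈ W, ζ A ∈ A.1) : W = ∅ := by
  rw [Set.eq_empty_iff_forall_notMem]
  intro A hA
  obtain ⟨a, ha⟩ : ∃ a, a = ζ A := ⟨_, rfl⟩
  have haA : a ∈ A.1 := ha ▸ hmem A hA
  have hΦ := continuous_splitPoint A a
  have hΦ0 : splitPoint A a 0 = A := splitPoint_zero haA
  -- `A` is finite, so its other points stay away from `a`; for small `u` the selected point must be
  -- `a + u` or `a - u`.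
  have hfar : ((A.1 \ {a})ᶜ : Set ℂ) ∈ nhds a :=
    (A.2.1.sdiff).isClosed.isOpen_compl.mem_nhds (by simp)
  have hζA : Filter.Tendsto ζ (nhds A) (nhds a) := by
    rw [ha]; exact hζ.continuousAt (hW.mem_nhds hA)
  have hev : ∀ᶠ u in nhds (0 : ℂ), splitPoint A a u ∈ W ∧ ζ (splitPoint A a u) ∈ (A.1 \ {a})ᶜ := by
    have ht : Filter.Tendsto (splitPoint A a) (nhds 0) (nhds A) := by
      simpa [hΦ0] using hΦ.tendsto 0
    have hWA : ∀ᶠ B in nhds A, B ∈ W := hW.mem_nhds hA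
    exact ht.eventually (hWA.and (hζA.eventually hfar))
  obtain ⟨δ, hδ, hball⟩ := Metric.eventually_nhds_iff.1 hev
  have hcirc : ∀ θ : ℝ, dist (((δ / 2 : ℝ) : ℂ) * Complex.exp (θ * Complex.I)) 0 < δ := by
    intro θ
    rw [dist_zero_right, norm_mul, Complex.norm_exp_ofReal_mul_I, Complex.norm_real,
      Real.norm_of_nonneg (by positivity)]
    linarith
  set c : ℝ → ℂ := fun θ => ((δ / 2 : ℝ) : ℂ) * Complex.exp (θ * Complex.I) with hc
  have hc0 : ∀ θ, c θ ≠ 0 := fun θ =>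
    mul_ne_zero (Complex.ofReal_ne_zero.2 (by positivity)) (Complex.exp_ne_zero _)
  have hcc : Continuous c := by fun_prop
  have hcpi : c Real.pi = -c 0 := by simp [hc, Complex.exp_pi_mul_I]
  -- `g θ` is the selected sign: `1` for `a + c θ` and `-1` for `a - c θ`.
  set g : ℝ → ℝ := fun θ => ((ζ (splitPoint A a (c θ)) - a) / c θ).re with hg
  have hgc : Continuous g := by
    refine Complex.continuous_re.comp ?_
    refine Continuous.div₀ (Continuous.sub ?_ continuous_const) hcc hc0
    exact hζ.comp_continuous (hΦ.comp hcc) fun θ => (hball (hcirc θ)).1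
  have hg1 : ∀ θ, g θ = 1 ∨ g θ = -1 := by
    intro θ
    obtain ⟨h1, h2⟩ := hball (hcirc θ)
    rcases hmem _ h1 with h | h | h
    · exact absurd h h2
    · left
      simp only [hg]
      rw [h, add_sub_cancel_left, div_self (hc0 θ), Complex.one_re]
    · right
      simp only [hg]
      rw [Set.mem_singleton_iff.1 h, sub_sub_cancel_left, neg_div, div_self (hc0 θ),
        Complex.neg_re, Complex.one_re]
  have hgpi : g Real.pi = -g 0 := by
    simp only [hg]
    rw [hcpi, splitPoint_neg, div_neg, Complex.neg_re]
  -- The sign flips between `0` and `π`, so by the intermediate value theorem it would have to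
  -- vanish somewhere.
  have hzero : (0 : ℝ) ∈ Set.range g := by
    rcases hg1 0 with h | h
    · exact mem_range_of_exists_le_of_exists_ge hgc ⟨Real.pi, by rw [hgpi, h]; norm_num⟩
        ⟨0, by rw [h]; norm_num⟩
    · exact mem_range_of_exists_le_of_exists_ge hgc ⟨0, by rw [h]; norm_num⟩
        ⟨Real.pi, by rw [hgpi, h]; norm_num⟩
  obtain ⟨θ, hθ⟩ := hzero
  rcases hg1 θ with h | h <;> rw [hθ] at h <;> norm_num at h

/-! ### Real numbers of the model are continuous functions -/

variable {V : Opens F}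

namespace DReal

/-- The value at `A` of a real number of the model. -/
noncomputable def eval (x : DReal V) (A : F) : ℝ :=
  sSup {r : ℝ | ∃ q : ℚ, A ∈ x.lower q ∧ (q : ℝ) = r}

theorem lower_lt_upper (x : DReal V) {A : F} {p q : ℚ} (hp : A ∈ x.lower p) (hq : A ∈ x.upper q) :
    p < q := by
  by_contra! h
  have hp' : A ∈ x.upper p := by
    rcases h.eq_or_lt with rfl | h
    · exact hq
    · rw [x.upper_rounded p]
      simp only [Opens.mem_iSup]
      exact ⟨q, h, hq⟩
  have : A ∈ x.lower p ⊓ x.upper p := ⟨hp, hp'⟩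
  rw [x.disjoint] at this
  exact this

theorem exists_mem_lower (x : DReal V) {A : F} (hA : A ∈ V) : ∃ q, A ∈ x.lower q := by
  simpa using x.lower_inhabited hA

theorem exists_mem_upper (x : DReal V) {A : F} (hA : A ∈ V) : ∃ q, A ∈ x.upper q := by
  simpa using x.upper_inhabited hA

/-- Roundedness makes the inequality strict. The hypothesis `A ∈ V` matters: elsewhere no rational
is in the lower cut and `eval` has the default value `0`. -/
theorem mem_lower_iff (x : DReal V) {A : F} (hA : A ∈ V) (q : ℚ) :
    A ∈ x.lower q ↔ (q : ℝ) < x.eval A := by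
  obtain ⟨u, hu⟩ := x.exists_mem_upper hA
  obtain ⟨l, hl⟩ := x.exists_mem_lower hA
  have hb : BddAbove {r : ℝ | ∃ q : ℚ, A ∈ x.lower q ∧ (q : ℝ) = r} := by
    refine ⟨u, ?_⟩
    rintro _ ⟨p, hp, rfl⟩
    exact_mod_cast (x.lower_lt_upper hp hu).le
  constructor
  · intro h
    rw [x.lower_rounded q] at h
    simp only [Opens.mem_iSup] at h
    obtain ⟨p, hqp, hp⟩ := h
    exact lt_of_lt_of_le (by exact_mod_cast hqp) (le_csSup hb ⟨p, hp, rfl⟩)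
  · intro h
    have hne : {r : ℝ | ∃ q : ℚ, A ∈ x.lower q ∧ (q : ℝ) = r}.Nonempty := ⟨l, l, hl, rfl⟩
    obtain ⟨_, ⟨p, hp, rfl⟩, hqp⟩ := exists_lt_of_lt_csSup hne h
    rw [x.lower_rounded q]
    simp only [Opens.mem_iSup]
    exact ⟨p, by exact_mod_cast hqp, hp⟩

theorem mem_upper_iff (x : DReal V) {A : F} (hA : A ∈ V) (q : ℚ) :
    A ∈ x.upper q ↔ x.eval A < q := by
  constructor
  · intro h
    rw [x.upper_rounded q] at h
    simp only [Opens.mem_iSup] at h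
    obtain ⟨p, hpq, hp⟩ := h
    have hle : x.eval A ≤ p := by
      by_contra! hlt
      exact lt_irrefl p (x.lower_lt_upper ((x.mem_lower_iff hA p).2 hlt) hp)
    exact hle.trans_lt (by exact_mod_cast hpq)
  · intro h
    obtain ⟨p, hp, hpq⟩ := exists_rat_btwn h
    -- Locatedness is what makes the supremum of the lower cut also the infimum of the upper cut.
    rcases x.located p q (by exact_mod_cast hpq) hA with h' | h'
    · exact absurd ((x.mem_lower_iff hA p).1 h') hp.not_gt
    · exact h'

theorem continuousOn_eval (x : DReal V) : ContinuousOn x.eval V := by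
  intro A hA
  refine tendsto_order.2 ⟨fun r hr => ?_, fun r hr => ?_⟩
  · obtain ⟨q, hrq, hq⟩ := exists_rat_btwn hr
    refine nhdsWithin_le_nhds ?_
    filter_upwards [(x.lower q).2.mem_nhds ((x.mem_lower_iff hA q).2 hq)] with B hB
    exact hrq.trans ((x.mem_lower_iff (x.lower_le q hB) q).1 hB)
  · obtain ⟨q, hq, hqr⟩ := exists_rat_btwn hr
    refine nhdsWithin_le_nhds ?_
    filter_upwards [(x.upper q).2.mem_nhds ((x.mem_upper_iff hA q).2 hq)] with B hB
    exact ((x.mem_upper_iff (x.upper_le q hB) q).1 hB).trans hqr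

theorem eval_eq_of_mem_lower_iff (x : DReal V) {A : F} {r : ℝ} (hA : A ∈ V)
    (h : ∀ q : ℚ, A ∈ x.lower q ↔ (q : ℝ) < r) : x.eval A = r := by
  refine eq_of_forall_rat_lt_iff_lt fun q => ?_
  rw [← h, x.mem_lower_iff hA]

theorem eval_restrict {W : Opens F} (h : W ≤ V) (x : DReal V) {A : F} (hA : A ∈ W) :
    (x.restrict h).eval A = x.eval A := by
  refine eval_eq_of_mem_lower_iff _ hA fun q => ?_
  rw [← x.mem_lower_iff (h hA)]
  exact and_iff_left hA

theorem eval_const (r : ℝ) (A : F) : (DReal.const r).eval A = r := by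
  refine eval_eq_of_mem_lower_iff _ trivial fun q => ?_
  simp [DReal.const]

/-- The real number of the model given by a continuous function. -/
def ofFun (f : F → ℝ) (hf : ContinuousOn f V) : DReal V where
  lower q := ⟨{A | A ∈ V ∧ (q : ℝ) < f A}, hf.isOpen_inter_preimage V.2 isOpen_Ioi⟩
  upper q := ⟨{A | A ∈ V ∧ f A < (q : ℝ)}, hf.isOpen_inter_preimage V.2 isOpen_Iio⟩
  lower_le _ _ h := h.1
  upper_le _ _ h := h.1
  lower_inhabited A hA := by
    obtain ⟨q, hq⟩ := exists_rat_lt (f A)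
    exact Opens.mem_iSup.2 ⟨q, hA, hq⟩
  upper_inhabited A hA := by
    obtain ⟨q, hq⟩ := exists_rat_gt (f A)
    exact Opens.mem_iSup.2 ⟨q, hA, hq⟩
  lower_rounded q := by
    ext A
    simp only [SetLike.mem_coe, Opens.mem_iSup]
    constructor
    · rintro ⟨hA, h⟩
      obtain ⟨p, hp, hp'⟩ := exists_rat_btwn h
      exact ⟨p, by exact_mod_cast hp, hA, hp'⟩
    · rintro ⟨p, hp, hA, h⟩
      exact ⟨hA, lt_trans (by exact_mod_cast hp) h⟩
  upper_rounded q := by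
    ext A
    simp only [SetLike.mem_coe, Opens.mem_iSup]
    constructor
    · rintro ⟨hA, h⟩
      obtain ⟨p, hp, hp'⟩ := exists_rat_btwn h
      exact ⟨p, by exact_mod_cast hp', hA, hp⟩
    · rintro ⟨p, hp, hA, h⟩
      exact ⟨hA, h.trans (by exact_mod_cast hp)⟩
  disjoint q := by
    ext A
    simp only [SetLike.mem_coe]
    refine ⟨?_, fun h => h.elim⟩
    rintro ⟨⟨_, h⟩, ⟨_, h'⟩⟩
    exact lt_asymm h h'
  located p q hpq A hA := by
    rcases lt_or_ge (p : ℝ) (f A) with h | h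
    · exact Or.inl ⟨hA, h⟩
    · exact Or.inr ⟨hA, h.trans_lt (by exact_mod_cast hpq)⟩

theorem mem_lower_ofFun {f : F → ℝ} {hf : ContinuousOn f V} {A : F} {q : ℚ} :
    A ∈ (ofFun f hf).lower q ↔ A ∈ V ∧ (q : ℝ) < f A :=
  Iff.rfl

theorem mem_upper_ofFun {f : F → ℝ} {hf : ContinuousOn f V} {A : F} {q : ℚ} :
    A ∈ (ofFun f hf).upper q ↔ A ∈ V ∧ f A < q :=
  Iff.rfl

end DReal

theorem lt_of_mem_subLt {x y : DReal V} {q : ℚ} {A : F} (h : A ∈ subLt x y q) :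
    A ∈ V ∧ x.eval A - y.eval A < q := by
  simp only [subLt, Opens.mem_iSup] at h
  obtain ⟨s, hx, hy⟩ := h
  have hA := x.upper_le _ hx
  have hx' := (x.mem_upper_iff hA _).1 hx
  have hy' := (y.mem_lower_iff hA _).1 hy
  push_cast at hx'
  exact ⟨hA, by linarith⟩

theorem abs_lt_of_mem_absSubLt {x y : DReal V} {q : ℚ} {A : F} (h : A ∈ absSubLt x y q) :
    A ∈ V ∧ |x.eval A - y.eval A| < q := by
  obtain ⟨hA, h1⟩ := lt_of_mem_subLt h.1
  have h2 := (lt_of_mem_subLt h.2).2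
  exact ⟨hA, abs_lt.2 ⟨by linarith, h1⟩⟩

namespace DComplex

/-- The value at `A` of a complex number of the model. -/
noncomputable def eval (z : DComplex V) (A : F) : ℂ := ⟨z.re.eval A, z.im.eval A⟩

theorem continuousOn_eval (z : DComplex V) : ContinuousOn z.eval V := by
  have h : z.eval = fun A => Complex.equivRealProdCLM.symm (z.re.eval A, z.im.eval A) := rfl
  rw [h]
  exact Complex.equivRealProdCLM.symm.continuous.comp_continuousOn
    (z.re.continuousOn_eval.prodMk z.im.continuousOn_eval)

theorem eval_restrict {W : Opens F} (h : W ≤ V) (z : DComplex V) {A : F} (hA : A ∈ W) :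
    (z.restrict h).eval A = z.eval A :=
  Complex.ext (z.re.eval_restrict h hA) (z.im.eval_restrict h hA)

theorem eval_const (z : ℂ) (A : F) : (DComplex.const z).eval A = z :=
  Complex.ext (DReal.eval_const _ _) (DReal.eval_const _ _)

end DComplex

theorem eval_mem_of_mem_memOpen {z : DComplex V} {N : Opens ℂ} {A : F} (h : A ∈ memOpen z N) :
    z.eval A ∈ N := by
  simp only [memOpen, Opens.mem_iSup] at h
  obtain ⟨a, b, c, e, hN, ⟨ha, hb⟩, ⟨hc, he⟩⟩ := h
  have hA := z.re.lower_le _ ha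
  exact hN _ ((z.re.mem_lower_iff hA _).1 ha) ((z.re.mem_upper_iff hA _).1 hb)
    ((z.im.mem_lower_iff hA _).1 hc) ((z.im.mem_upper_iff hA _).1 he)

theorem eval_mem_of_mem_memH {z : DComplex V} {A : F} (h : A ∈ memH z) : z.eval A ∈ A.1 := by
  by_contra hz
  -- The test set is everything except the value of `z` at `A`. It contains `A`, so `{O}` is a
  -- normal-form neighbourhood of `A`.
  let O : Opens ℂ := ⟨{z.eval A}ᶜ, isOpen_compl_singleton⟩
  have hP : ({O} : Set (Opens ℂ)).Finite := Set.finite_singleton O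
  have hAO : A.1 ⊆ (O : Set ℂ) := fun a ha haz => hz (Set.mem_singleton_iff.1 haz ▸ ha)
  have hA : A ∈ normalOpen {O} hP := by
    rw [mem_normalOpen, sSup_singleton]
    refine ⟨?_, hAO⟩
    rintro _ rfl
    rw [Set.inter_eq_left.2 hAO]
    exact A.2.2
  have himp : A ∈ normalOpen {O} hP ⇨ memOpen z (sSup {O}) :=
    (inf_le_right.trans (iInf₂_le _ hP) : memH z ≤ _) h
  have hle : (normalOpen {O} hP ⇨ memOpen z (sSup {O})) ⊓ normalOpen {O} hP ≤
      memOpen z (sSup {O}) := himp_inf_le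
  have := eval_mem_of_mem_memOpen (hle ⟨himp, hA⟩)
  rw [sSup_singleton] at this
  exact this rfl

theorem eq_bot_of_forall_eval_mem (z : DComplex V) {W : Opens F} (hWV : W ≤ V)
    (h : ∀ A ∈ W, z.eval A ∈ A.1) : W = ⊥ :=
  Opens.ext (eq_empty_of_continuousOn_selection W.2 (z.continuousOn_eval.mono hWV) h)

theorem memH_eq_bot (z : DComplex V) : memH z = ⊥ :=
  eq_bot_of_forall_eval_mem z inf_le_left fun _ => eval_mem_of_mem_memH

/-! ### Minima over finite sets -/

/-- The minimum of `g` on the finite set `A`. -/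
noncomputable def minOn (g : ℂ → ℝ) (A : F) : ℝ := sInf (g '' A.1)

theorem minOn_le (g : ℂ → ℝ) {A : F} {a : ℂ} (ha : a ∈ A.1) : minOn g A ≤ g a :=
  csInf_le (A.2.1.image g).bddBelow ⟨a, ha, rfl⟩

theorem exists_eq_minOn (g : ℂ → ℝ) (A : F) : ∃ a ∈ A.1, g a = minOn g A :=
  (A.2.2.image g).csInf_mem (A.2.1.image g)

theorem lt_minOn_iff {g : ℂ → ℝ} {A : F} {r : ℝ} : r < minOn g A ↔ ∀ a ∈ A.1, r < g a := by
  refine ⟨fun h a ha => h.trans_le (minOn_le g ha), fun h => ?_⟩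
  obtain ⟨a, ha, hga⟩ := exists_eq_minOn g A
  exact hga ▸ h a ha

theorem minOn_lt_iff {g : ℂ → ℝ} {A : F} {r : ℝ} : minOn g A < r ↔ ∃ a ∈ A.1, g a < r := by
  refine ⟨fun h => ?_, fun ⟨a, ha, h⟩ => (minOn_le g ha).trans_lt h⟩
  obtain ⟨a, ha, hga⟩ := exists_eq_minOn g A
  exact ⟨a, ha, hga ▸ h⟩

/-- The two kinds of information give the two halves: a lower bound on the minimum is the negative
condition `A ⊆ {r < g}`, an upper bound the positive condition that `A` meets `{g < r}`. -/
theorem continuous_minOn {g : ℂ → ℝ} (hg : Continuous g) : Continuous (minOn g) := by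
  rw [continuous_iff_continuousAt]
  intro A
  refine tendsto_order.2 ⟨fun r hr => ?_, fun r hr => ?_⟩
  · filter_upwards [(isOpen_subset (isOpen_lt continuous_const hg)).mem_nhds
      (show A ∈ {A : F | A.1 ⊆ {a | r < g a}} from lt_minOn_iff.1 hr)] with B hB
    exact lt_minOn_iff.2 hB
  · filter_upwards [(isOpen_meets (isOpen_lt hg continuous_const)).mem_nhds
      (show A ∈ {A : F | (A.1 ∩ {a | g a < r}).Nonempty} from minOn_lt_iff.1 hr)] with B hB
    exact minOn_lt_iff.2 hB

/-! ### Infima in the Riesz space -/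

/-- Only negative information is needed: the open set `{p < r}`, with `q < p` below the minimum,
serves as `N`. -/
theorem mem_rieszRatLt_iff {r : ℂ → ℝ} (hr : Continuous r) {q : ℚ} {A : F} :
    A ∈ rieszRatLt q r ↔ (q : ℝ) < minOn r A := by
  simp only [rieszRatLt, rieszLe, rieszEq, Opens.mem_iSup]
  constructor
  · rintro ⟨p, hqp, P, hP, N, hN, -, hAN⟩
    refine lt_minOn_iff.2 fun a ha => lt_of_lt_of_le (by exact_mod_cast hqp : (q : ℝ) < p) ?_
    have := hN a (hAN ha)
    simpa using this
  · intro h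
    obtain ⟨p, hqp, hp⟩ := exists_rat_btwn h
    refine ⟨p, by exact_mod_cast hqp, ∅, Set.finite_empty,
      ⟨{a | (p : ℝ) < r a}, isOpen_lt continuous_const hr⟩, fun w hw => ?_, ?_⟩
    · simpa using le_of_lt hw
    · exact ⟨by simp, lt_minOn_iff.1 hp⟩

theorem isRieszInf_of_eval_eq {r : ℂ → ℝ} (hr : Continuous r) {x : DReal ⊤}
    (hx : ∀ A, x.eval A = minOn r A) : IsRieszInf r x := by
  refine ⟨fun q => ?_, fun q => ?_⟩
  · ext A
    rw [SetLike.mem_coe, SetLike.mem_coe, mem_rieszRatLt_iff hr, x.mem_lower_iff trivial, hx]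
  · ext A
    simp only [SetLike.mem_coe, Opens.mem_iSup]
    rw [x.mem_upper_iff trivial, hx]
    constructor
    · intro h
      obtain ⟨p, hp, hpq⟩ := exists_rat_btwn h
      refine ⟨p, by exact_mod_cast hpq, ?_⟩
      -- Negation is the interior of the complement, so a pointwise inequality at `A` is not enough;
      -- the open set `x.upper p` is a neighbourhood of `A` disjoint from `p < r`.
      have hle : x.upper p ≤ (rieszRatLt p r)ᶜ := by
        rw [le_compl_iff_disjoint_right, disjoint_iff, ← x.disjoint p, inf_comm]
        congr 1
        ext B
        rw [SetLike.mem_coe, SetLike.mem_coe, mem_rieszRatLt_iff hr, x.mem_lower_iff trivial, hx]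
      exact hle ((x.mem_upper_iff trivial p).2 (by rwa [hx]))
    · rintro ⟨p, hpq, hp⟩
      refine lt_of_le_of_lt ?_ (by exact_mod_cast hpq : (p : ℝ) < q)
      by_contra! hlt
      have hbot : A ∈ rieszRatLt p r ⊓ (rieszRatLt p r)ᶜ := ⟨(mem_rieszRatLt_iff hr).2 hlt, hp⟩
      rw [inf_compl_self] at hbot
      exact hbot

theorem IsRieszSubspace.abs_sub_const_mem {S : Set (ℂ → ℝ)} (hS : IsRieszSubspace S)
    (h1 : (1 : ℂ → ℝ) ∈ S) {f : ℂ → ℝ} (hf : f ∈ S) (c : ℝ) : (fun w => |f w - c|) ∈ S := by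
  have hsub : f + (-c) • (1 : ℂ → ℝ) ∈ S := hS.add_mem _ hf _ (hS.smul_mem _ _ h1)
  -- The absolute value is the join of a function and its negative.
  convert hS.sup_mem _ hsub _ (hS.smul_mem (-1) _ hsub) using 1
  ext w
  simp [abs, sub_eq_add_neg, add_comm]

theorem taxiElt_mem_rieszR (z : ℂ) : taxiElt z ∈ rieszR := by
  rintro S ⟨hS, hgen⟩
  have h1 : (1 : ℂ → ℝ) ∈ S := hgen (by simp [generators])
  exact hS.add_mem _ (hS.abs_sub_const_mem h1 (hgen (by simp [generators])) z.re)
    _ (hS.abs_sub_const_mem h1 (hgen (by simp [generators])) z.im)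

theorem euclidElt_mem_rieszRSq (z : ℂ) : euclidElt z ∈ rieszRSq := by
  rintro S ⟨hS, hsq, hgen⟩
  have h1 : (1 : ℂ → ℝ) ∈ S := hgen (by simp [generators])
  exact hS.add_mem _ (hsq _ (hS.abs_sub_const_mem h1 (hgen (by simp [generators])) z.re))
    _ (hsq _ (hS.abs_sub_const_mem h1 (hgen (by simp [generators])) z.im))

/-! ### The distance function of a metric on the plane -/

/-- `m` is a metric on `ℂ` that is continuous for the usual topology and bounds the difference
of the real parts. -/
structure IsPlaneMetric (m : ℂ → ℂ → ℝ) : Prop where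
  self : ∀ z, m z z = 0
  nonneg : ∀ z w, 0 ≤ m z w
  eq_of_eq_zero : ∀ z w, m z w = 0 → z = w
  triangle : ∀ z w u, m z u ≤ m z w + m w u
  continuous : Continuous (Function.uncurry m)
  abs_re_le : ∀ z w, |z.re - w.re| ≤ m z w

namespace IsPlaneMetric

variable {m : ℂ → ℂ → ℝ}

theorem continuous_right (hm : IsPlaneMetric m) (z : ℂ) : Continuous (m z) :=
  hm.continuous.comp (continuous_const.prodMk continuous_id)

theorem minOn_le_add (hm : IsPlaneMetric m) (z w : ℂ) (A : F) :
    minOn (m z) A ≤ m z w + minOn (m w) A := by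
  obtain ⟨a, ha, h⟩ := exists_eq_minOn (m w) A
  rw [← h]
  exact (minOn_le _ ha).trans (hm.triangle z w a)

theorem minOn_nonneg (hm : IsPlaneMetric m) (z : ℂ) (A : F) : 0 ≤ minOn (m z) A := by
  obtain ⟨a, -, h⟩ := exists_eq_minOn (m z) A
  exact h ▸ hm.nonneg z a

/-- Both `ζ B` and the set `B` vary. By the triangle inequality, replacing `ζ B` by the fixed `ζ A`
costs at most the distance between them, which tends to `0`; squeezing reduces to
`continuous_minOn`. -/
theorem continuousOn_minOn (hm : IsPlaneMetric m) {s : Set F} {ζ : F → ℂ}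
    (hζ : ContinuousOn ζ s) : ContinuousOn (fun A => minOn (m (ζ A)) A) s := by
  intro A hA
  have h0 : Filter.Tendsto (minOn (m (ζ A))) (nhdsWithin A s) (nhds (minOn (m (ζ A)) A)) :=
    (continuous_minOn (hm.continuous_right (ζ A))).continuousWithinAt
  have hl : Filter.Tendsto (fun B => m (ζ A) (ζ B)) (nhdsWithin A s) (nhds 0) := by
    have := (hm.continuous.tendsto (ζ A, ζ A)).comp (tendsto_const_nhds.prodMk_nhds (hζ A hA))
    simpa only [Function.comp_def, Function.uncurry, hm.self] using this
  have hr : Filter.Tendsto (fun B => m (ζ B) (ζ A)) (nhdsWithin A s) (nhds 0) := by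
    have := (hm.continuous.tendsto (ζ A, ζ A)).comp ((hζ A hA).prodMk_nhds tendsto_const_nhds)
    simpa only [Function.comp_def, Function.uncurry, hm.self] using this
  have h1 := h0.sub hl
  have h2 := hr.add h0
  rw [sub_zero] at h1
  rw [zero_add] at h2
  refine tendsto_of_tendsto_of_tendsto_of_le_of_le h1 h2 (fun B => ?_) (fun B => ?_)
  · have := hm.minOn_le_add (ζ A) (ζ B) B
    simp only
    linarith
  · exact hm.minOn_le_add (ζ B) (ζ A) B

/-- The function of the model that sends `z` to the real number with value the `m`-distance from
`z` to `A` at the point `A` of `F`. -/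
noncomputable def distH (hm : IsPlaneMetric m) : DFun where
  app V z := DReal.ofFun (V := V) (fun A => minOn (m (z.eval A)) A)
    (hm.continuousOn_minOn z.continuousOn_eval)
  app_restrict V W h z := by
    refine DReal.ext (funext fun q => Opens.ext (Set.ext fun A => ?_))
      (funext fun q => Opens.ext (Set.ext fun A => ?_))
    all_goals
      simp only [SetLike.mem_coe, DReal.restrict, Opens.mem_inf, DReal.mem_lower_ofFun,
        DReal.mem_upper_ofFun]
      constructor
      · rintro ⟨hA, hq⟩
        rw [z.eval_restrict h hA] at hq
        exact ⟨⟨h hA, hq⟩, hA⟩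
      · rintro ⟨⟨-, hq⟩, hA⟩
        rw [z.eval_restrict h hA]
        exact ⟨hA, hq⟩

theorem mem_lower_distH (hm : IsPlaneMetric m) {z : DComplex V} {A : F} {q : ℚ} :
    A ∈ (hm.distH.app V z).lower q ↔ A ∈ V ∧ (q : ℝ) < minOn (m (z.eval A)) A :=
  Iff.rfl

theorem mem_upper_distH (hm : IsPlaneMetric m) {z : DComplex V} {A : F} {q : ℚ} :
    A ∈ (hm.distH.app V z).upper q ↔ A ∈ V ∧ minOn (m (z.eval A)) A < q :=
  Iff.rfl

theorem mem_lower_distH_const (hm : IsPlaneMetric m) {z : ℂ} {A : F} {q : ℚ} :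
    A ∈ (hm.distH.app ⊤ (DComplex.const z)).lower q ↔ (q : ℝ) < minOn (m z) A := by
  rw [mem_lower_distH, DComplex.eval_const]
  exact and_iff_right trivial

theorem mem_upper_distH_const (hm : IsPlaneMetric m) {z : ℂ} {A : F} {q : ℚ} :
    A ∈ (hm.distH.app ⊤ (DComplex.const z)).upper q ↔ minOn (m z) A < q := by
  rw [mem_upper_distH, DComplex.eval_const]
  exact and_iff_right trivial

theorem eval_distH_const (hm : IsPlaneMetric m) (z : ℂ) (A : F) :
    (hm.distH.app ⊤ (DComplex.const z)).eval A = minOn (m z) A :=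
  DReal.eval_eq_of_mem_lower_iff _ trivial fun _ => hm.mem_lower_distH_const

theorem exists_lt_minOn (hm : IsPlaneMetric m) (K : ℝ) (A : F) : ∃ z, K < minOn (m z) A := by
  obtain ⟨b, hb⟩ := (A.2.1.image Complex.re).bddAbove
  -- A real point more than `K` to the right of all of `A`.
  refine ⟨((b + K + 1 : ℝ) : ℂ), lt_minOn_iff.2 fun a ha => ?_⟩
  have h1 : a.re ≤ b := hb ⟨a, ha, rfl⟩
  have h2 := (le_abs_self _).trans (hm.abs_re_le ((b + K + 1 : ℝ) : ℂ) a)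
  rw [Complex.ofReal_re] at h2
  linarith

/-- One direction of the pointwise reading of `mLt` suffices, since the Lipschitz condition only
bounds `mLt` from above. -/
theorem isNontrivialDistanceToH_distH (hm : IsPlaneMetric m)
    {mLt : ∀ V : Opens F, DComplex V → DComplex V → ℚ → Opens F}
    (hlt : ∀ (V : Opens F) (z w : DComplex V) (q : ℚ), ∀ A ∈ mLt V z w q,
      A ∈ V ∧ m (z.eval A) (w.eval A) < q) :
    IsNontrivialDistanceToH m mLt hm.distH where
  nonneg V z q hq := by
    refine le_antisymm ((hm.distH.app V z).lower_le q) fun A hA => hm.mem_lower_distH.2 ⟨hA, ?_⟩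
    exact lt_of_lt_of_le (by exact_mod_cast hq) (hm.minOn_nonneg _ A)
  lipschitz V z w q A h := by
    obtain ⟨hA, h⟩ := hlt V z w q A h
    have hle := hm.minOn_le_add (z.eval A) (w.eval A) A
    -- The rational `s` witnesses `subLt`: it satisfies `d(z) < s + q` and `s < d(w)` at `A`.
    obtain ⟨s, hs, hs'⟩ := exists_rat_btwn
      (show minOn (m (z.eval A)) A - q < minOn (m (w.eval A)) A by linarith)
    simp only [subLt, Opens.mem_iSup]
    refine ⟨s, hm.mem_upper_distH.2 ⟨hA, ?_⟩, hm.mem_lower_distH.2 ⟨hA, hs'⟩⟩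
    push_cast
    linarith
  zero_iff V z := by
    rw [memH_eq_bot]
    refine eq_bot_of_forall_eval_mem z inf_le_left fun A ⟨hA, hA0⟩ => ?_
    have hle : minOn (m (z.eval A)) A ≤ 0 := by
      by_contra! hlt
      have hbot : A ∈ (hm.distH.app V z).lower 0 ⊓ ((hm.distH.app V z).lower 0)ᶜ :=
        ⟨hm.mem_lower_distH.2 ⟨hA, by simpa using hlt⟩, hA0⟩
      rw [inf_compl_self] at hbot
      exact hbot
    obtain ⟨a, ha, h⟩ := exists_eq_minOn (m (z.eval A)) A
    have hza := hm.eq_of_eq_zero _ a (le_antisymm (h ▸ hle) (hm.nonneg _ _))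
    exact hza ▸ ha
  lower_bound P hP z q hq := by
    rw [eq_bot_iff]
    rintro A ⟨hA, hAq⟩
    obtain ⟨a, ha, h⟩ := minOn_lt_iff.1 (hm.mem_upper_distH_const.1 hAq)
    exact (hq a ((mem_normalOpen.1 hA).2 ha)).not_gt h
  upper_bound P hP ε z q hdiam hq A hA := by
    obtain ⟨w, hw, hwq⟩ := hq
    obtain ⟨O, hO, hwO⟩ := Opens.mem_sSup.1 hw
    -- `A` meets the piece `O` containing `w`, so it has a point within `ε` of `w`.
    obtain ⟨a, ha, haO⟩ := (mem_normalOpen.1 hA).1 O hO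
    refine hm.mem_upper_distH_const.2 (minOn_lt_iff.2 ⟨a, ha, ?_⟩)
    have h1 := hdiam O hO w hwO a haO
    have h2 := hm.triangle z w a
    linarith
  exists_small ε hε := by
    refine eq_top_iff.2 fun A _ => ?_
    obtain ⟨a, ha⟩ := A.2.2
    refine Opens.mem_iSup.2 ⟨a, hm.mem_upper_distH_const.2 (minOn_lt_iff.2 ⟨a, ha, ?_⟩)⟩
    rw [hm.self]
    exact_mod_cast hε
  exists_large K := by
    refine eq_top_iff.2 fun A _ => ?_
    obtain ⟨z, hz⟩ := hm.exists_lt_minOn K A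
    exact Opens.mem_iSup.2 ⟨z, hm.mem_lower_distH_const.2 hz⟩

end IsPlaneMetric

/-! ### The two metrics -/

theorem isPlaneMetric_taxi : IsPlaneMetric taxi where
  self z := by simp [taxi]
  nonneg z w := by unfold taxi; positivity
  eq_of_eq_zero z w h := by
    unfold taxi at h
    have h1 := abs_nonneg (z.re - w.re)
    have h2 := abs_nonneg (z.im - w.im)
    exact Complex.ext (sub_eq_zero.1 (abs_eq_zero.1 (by linarith)))
      (sub_eq_zero.1 (abs_eq_zero.1 (by linarith)))
  triangle z w u := by
    have h1 := abs_sub_le z.re w.re u.re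
    have h2 := abs_sub_le z.im w.im u.im
    unfold taxi
    linarith
  continuous := by
    unfold taxi Function.uncurry
    fun_prop
  abs_re_le z w := by
    unfold taxi
    linarith [abs_nonneg (z.im - w.im)]

theorem isPlaneMetric_dist : IsPlaneMetric (fun z w : ℂ => dist z w) where
  self := dist_self
  nonneg _ _ := dist_nonneg
  eq_of_eq_zero _ _ := eq_of_dist_eq_zero
  triangle := dist_triangle
  continuous := continuous_dist
  abs_re_le z w := by
    rw [Complex.dist_eq, ← Complex.sub_re]
    exact Complex.abs_re_le_norm _

theorem taxi_lt_of_mem_taxiLt {z w : DComplex V} {q : ℚ} {A : F} (h : A ∈ taxiLt V z w q) :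
    A ∈ V ∧ taxi (z.eval A) (w.eval A) < q := by
  simp only [taxiLt, Opens.mem_iSup] at h
  obtain ⟨a, b, hab, h1, h2⟩ := h
  obtain ⟨hA, h1⟩ := abs_lt_of_mem_absSubLt h1
  have h2 := (abs_lt_of_mem_absSubLt h2).2
  have hab' : (a : ℝ) + b ≤ q := by exact_mod_cast hab
  exact ⟨hA, (add_lt_add h1 h2).trans_le hab'⟩

theorem dist_sq (z w : ℂ) : dist z w ^ 2 = |z.re - w.re| ^ 2 + |z.im - w.im| ^ 2 := by
  rw [Complex.dist_eq, Complex.sq_norm, Complex.normSq_apply, sq_abs, sq_abs, Complex.sub_re,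
    Complex.sub_im]
  ring

theorem dist_lt_of_mem_euclidLt {z w : DComplex V} {q : ℚ} {A : F} (h : A ∈ euclidLt V z w q) :
    A ∈ V ∧ dist (z.eval A) (w.eval A) < q := by
  simp only [euclidLt, Opens.mem_iSup] at h
  obtain ⟨a, b, ⟨hq, hab⟩, h1, h2⟩ := h
  obtain ⟨hA, h1⟩ := abs_lt_of_mem_absSubLt h1
  have h2 := (abs_lt_of_mem_absSubLt h2).2
  have hab' : (a : ℝ) ^ 2 + (b : ℝ) ^ 2 ≤ (q : ℝ) ^ 2 := by exact_mod_cast hab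
  refine ⟨hA, lt_of_pow_lt_pow_left₀ 2 (by exact_mod_cast hq.le) ?_⟩
  rw [dist_sq]
  exact (add_lt_add (pow_lt_pow_left₀ h1 (abs_nonneg _) two_ne_zero)
    (pow_lt_pow_left₀ h2 (abs_nonneg _) two_ne_zero)).trans_le hab'

theorem taxiElt_eq (z : ℂ) : taxiElt z = taxi z := by
  ext w
  simp only [taxiElt, taxi, abs_sub_comm]

theorem euclidElt_eq (z : ℂ) : euclidElt z = fun w => dist z w ^ 2 := by
  ext w
  rw [dist_comm, dist_sq]
  rfl

theorem minOn_sq {g : ℂ → ℝ} (hg : ∀ a, 0 ≤ g a) (A : F) :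
    minOn (fun a => g a ^ 2) A = minOn g A ^ 2 := by
  obtain ⟨a, ha, h⟩ := exists_eq_minOn g A
  obtain ⟨b, hb, h'⟩ := exists_eq_minOn (fun a => g a ^ 2) A
  refine le_antisymm ?_ ?_
  · rw [← h]
    exact minOn_le (fun a => g a ^ 2) ha
  · rw [← h']
    exact pow_le_pow_left₀ (h ▸ hg a) (minOn_le g hb) 2

theorem isSqrt_of_eval_eq {e y : DReal V} (he : ∀ A ∈ V, 0 ≤ e.eval A)
    (hy : ∀ A ∈ V, y.eval A = e.eval A ^ 2) : IsSqrt e y := by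
  refine ⟨fun q hq => ?_, fun q hq => ?_, fun q hq => ?_, fun q hq => ?_⟩
  · refine le_antisymm (e.lower_le q) fun A hA => (e.mem_lower_iff hA q).2 ?_
    exact lt_of_lt_of_le (by exact_mod_cast hq) (he A hA)
  · have hiff : ∀ A ∈ V, (A ∈ e.lower q ↔ A ∈ y.lower (q ^ 2)) := fun A hA => by
      rw [e.mem_lower_iff hA, y.mem_lower_iff hA, hy A hA, Rat.cast_pow,
        pow_lt_pow_iff_left₀ (by exact_mod_cast hq) (he A hA) two_ne_zero]
    exact le_antisymm (fun A h => (hiff A (e.lower_le _ h)).1 h)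
      (fun A h => (hiff A (y.lower_le _ h)).2 h)
  · refine eq_bot_iff.2 fun A h => ?_
    have hA := e.upper_le q h
    have h1 := (e.mem_upper_iff hA q).1 h
    have h2 : (q : ℝ) ≤ 0 := by exact_mod_cast hq
    exact absurd (he A hA) (by linarith)
  · have hiff : ∀ A ∈ V, (A ∈ e.upper q ↔ A ∈ y.upper (q ^ 2)) := fun A hA => by
      rw [e.mem_upper_iff hA, y.mem_upper_iff hA, hy A hA, Rat.cast_pow,
        pow_lt_pow_iff_left₀ (he A hA) (by exact_mod_cast hq.le) two_ne_zero]
    exact le_antisymm (fun A h => (hiff A (e.upper_le _ h)).1 h)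
      (fun A h => (hiff A (y.upper_le _ h)).2 h)

end PointlessModel

theorem proposition11 :
    -- no stage forces anything to be a member of `H`
    (∀ (V : Opens F) (z : DComplex V), memH z = ⊥) ∧
    -- the taxicab distance function to `H`
    (∃ d : DFun, IsNontrivialDistanceToH taxi taxiLt d ∧
      ∀ z : ℂ, taxiElt z ∈ rieszR ∧
        IsRieszInf (taxiElt z) (d.app ⊤ (DComplex.const z))) ∧
    -- the Euclidean distance function to `H`
    (∃ d : DFun, IsNontrivialDistanceToH (fun z w => dist z w) euclidLt d ∧
      ∀ z : ℂ, euclidElt z ∈ rieszRSq ∧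
        ∃ y : DReal ⊤, IsRieszInf (euclidElt z) y ∧
          IsSqrt (d.app ⊤ (DComplex.const z)) y) := by
  refine ⟨fun V z => memH_eq_bot z,
    ⟨isPlaneMetric_taxi.distH,
      isPlaneMetric_taxi.isNontrivialDistanceToH_distH fun _ _ _ _ _ => taxi_lt_of_mem_taxiLt,
      fun z => ⟨taxiElt_mem_rieszR z, ?_⟩⟩,
    ⟨isPlaneMetric_dist.distH,
      isPlaneMetric_dist.isNontrivialDistanceToH_distH fun _ _ _ _ _ => dist_lt_of_mem_euclidLt,
      fun z => ⟨euclidElt_mem_rieszRSq z, ?_⟩⟩⟩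
  · rw [taxiElt_eq]
    exact isRieszInf_of_eval_eq (isPlaneMetric_taxi.continuous_right z)
      (isPlaneMetric_taxi.eval_distH_const z)
  · have hc : Continuous (euclidElt z) := by
      rw [euclidElt_eq]
      fun_prop
    -- The infimum in the enlarged Riesz space is the pointwise minimum of the squared distance;
    -- minima commute with squaring on non-negative functions.
    have hy : ∀ A, (DReal.ofFun (V := ⊤) _ (continuous_minOn hc).continuousOn).eval A =
        minOn (euclidElt z) A := fun A =>
      DReal.eval_eq_of_mem_lower_iff _ trivial fun _ => and_iff_right trivial
    refine ⟨_, isRieszInf_of_eval_eq hc hy, isSqrt_of_eval_eq (fun A _ => ?_) fun A _ => ?_⟩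
    · rw [isPlaneMetric_dist.eval_distH_const]
      exact isPlaneMetric_dist.minOn_nonneg z A
    · rw [hy, isPlaneMetric_dist.eval_distH_const, euclidElt_eq]
      exact minOn_sq (fun _ => dist_nonneg) A
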